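/- Let $\mathcal{C}$ be a triangulated category with suspension $\Sigma$ and class of distinguished triangles $\Delta$, and let $\mathcal{X},\mathcal{Y}$ be $\Sigma$-stable full additive subcategories of $\mathcal{C}$ closed under direct summands. A distinguished triangle $A\xrightarrow{f}B\xrightarrow{g}C\to\Sigma A$ is called $\mathcal{C}(\mathcal{X},-)$-exact if $\mathcal{C}(X,f)$ is injective and $\mathcal{C}(X,g)$ is surjective for every $X\in\mathcal{X}$, and $\mathcal{C}(-,\mathcal{Y})$-exact if $\mathcal{C}(g,Y)$ is injective and $\mathcal{C}(f,Y)$ is surjective for every $Y\in\mathcal{Y}$. Let $\xi_{\mathcal{X}}$ (respectively $\xi^{\mathcal{Y}}$) be the class of all $\mathcal{C}(\mathcal{X},-)$-exact (respectively $\mathcal{C}(-,\mathcal{Y})$-exact) distinguished triangles. Assume that $(\mathcal{X},\mathcal{Y})$ is a balanced pair, that is: $\mathcal{X}$ is contravariantly finite and $\mathcal{Y}$ is covariantly finite in $\mathcal{C}$; every object $M$ has an $\mathcal{X}$-resolution $\cdots\to X_1\to X_0\to M$, with all $X_n\in\mathcal{X}$, spliced from triangles $K_{n+1}\to X_n\to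 K_n\to\Sigma K_{n+1}$ ($n\ge 0$, $K_0=M$) in $\xi_{\mathcal{X}}$ that are $\mathcal{C}(-,\mathcal{Y})$-exact; and every object $N$ has a $\mathcal{Y}$-coresolution $N\to Y_0\to Y_{-1}\to\cdots$, with all terms $Y_{-n}\in\mathcal{Y}$, spliced in the same way, starting from a triangle $N\to Y_0\to L\to\Sigma N$, from triangles in $\xi^{\mathcal{Y}}$ that are $\mathcal{C}(\mathcal{X},-)$-exact. Then $\xi_{\mathcal{X}}=\xi^{\mathcal{Y}}=:\xi$, and $\xi$ is a proper class of triangles: $\xi\subseteq\Delta$ contains all split triangles and is closed under isomorphisms, finite coproducts, suspensions, base change and cobase change, and it is saturated, that is, if $A\to G\to E\to\Sigma A$ is the base change of a distinguished triangle $A\to B\to C\to\Sigma A$ along $\varepsilon\colon E\to C$, and if this base change and a triangle $M\to E\xrightarrow{\varepsilon}C\to\Sigma M$ are in $\xi$, then $A\to B\to C\to\Sigma A$ is in $\xi$. Let $\mathbb{E}(C,A)=\mathcal{C}(C,\Sigma A)$, and let $\mathfrak{s}(\delta)=[A\to B\to C]$ for any distinguished triangle $A\to B\to C\xrightarrow{\delta}\Sigma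 A$. Let $\mathbb{E}_\xi(C,A)\subseteq\mathbb{E}(C,A)$ consist of the $\delta$ that are realized by a triangle $A\to B\to C\xrightarrow{\delta}\Sigma A$ in $\xi$, and let $\mathfrak{s}_\xi=\mathfrak{s}|_{\mathbb{E}_\xi}$. Then $(\mathcal{C},\mathbb{E}_\xi,\mathfrak{s}_\xi)$ is an extriangulated category in the sense of Nakaoka and Palu. Moreover: 1. $(\mathcal{C},\mathbb{E}_\xi,\mathfrak{s}_\xi)$ is a triangulated category (that is, it is isomorphic to the extriangulated structure $(\mathcal{C}(-,\Sigma'-),\mathfrak{s}')$ given by some suspension $\Sigma'$ and some triangulation on the additive category $\mathcal{C}$) if and only if $\mathcal{X}=\mathcal{Y}=0$. 2. $(\mathcal{C},\mathbb{E}_\xi,\mathfrak{s}_\xi)$ is an exact category (that is, the sequences $A\to B\to C$ realizing the elements of $\mathbb{E}_\xi$ form an exact structure on $\mathcal{C}$ in the sense of Quillen) if and only if $\mathcal{X}=\mathcal{Y}=\mathcal{C}$. -/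

import Mathlib

open CategoryTheory CategoryTheory.Limits CategoryTheory.Pretriangulated Opposite

universe w v u

namespace RelTri

noncomputable section

/-! ## Extriangulated categories (Nakaoka–Palu) -/

section Extriangulated

variable {C : Type u} [Category.{v} C]

/-- A sequence `A ⟶ B ⟶ Z` with fixed end terms `A` and `Z`. -/
structure ShortSeq (A Z : C) where
  /-- the middle term -/
  mid : C
  /-- the first morphism -/
  i : A ⟶ mid
  /-- the second morphism -/
  p : mid ⟶ Z

/-- Two sequences with the same ends are equivalent if there is an isomorphism of the middle terms
inducing the identity on the end terms. -/
instance shortSeqSetoid (A Z : C) : Setoid (ShortSeq A Z) where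
  r S T := ∃ b : S.mid ≅ T.mid, S.i ≫ b.hom = T.i ∧ b.hom ≫ T.p = S.p
  iseqv :=
    { refl := fun S => ⟨Iso.refl _, by simp, by simp⟩
      symm := by
        rintro S T ⟨b, h₁, h₂⟩
        exact ⟨b.symm, by simp [← h₁], by simp [← h₂]⟩
      trans := by
        rintro S T U ⟨b, h₁, h₂⟩ ⟨c, h₃, h₄⟩
        exact ⟨b ≪≫ c, by simp [← h₃, ← h₁], by simp [← h₂, ← h₄]⟩ }

/-- Equivalence classes `[A ⟶ B ⟶ Z]`. -/
abbrev SeqClass (A Z : C) := Quotient (shortSeqSetoid A Z)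

/-- The equivalence class `[A ⟶ B ⟶ Z]` of a sequence. -/
def seqClass {A B Z : C} (i : A ⟶ B) (p : B ⟶ Z) : SeqClass A Z :=
  Quotient.mk _ ⟨B, i, p⟩

lemma seqClass_eq_iff {A B B' Z : C} (i : A ⟶ B) (p : B ⟶ Z) (i' : A ⟶ B') (p' : B' ⟶ Z) :
    seqClass i p = seqClass i' p' ↔ ∃ b : B ≅ B', i ≫ b.hom = i' ∧ b.hom ≫ p' = p :=
  Quotient.eq (r := shortSeqSetoid A Z)

/-- The type of `E`-extensions `E(Z, A)`. -/
abbrev Ext1 (E : Cᵒᵖ ⥤ C ⥤ AddCommGrpCat.{w}) (Z A : C) : Type w := (E.obj (op Z)).obj A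

/-- `a_* δ = E(Z, a)(δ)`. -/
def pushExt (E : Cᵒᵖ ⥤ C ⥤ AddCommGrpCat.{w}) {Z A A' : C} (a : A ⟶ A') (δ : Ext1 E Z A) :
    Ext1 E Z A' :=
  ((E.obj (op Z)).map a).hom δ

/-- `c^* δ = E(c, A)(δ)`. -/
def pullExt (E : Cᵒᵖ ⥤ C ⥤ AddCommGrpCat.{w}) {Z Z' A : C} (c : Z' ⟶ Z) (δ : Ext1 E Z A) :
    Ext1 E Z' A :=
  ((E.map c.op).app A).hom δ

/-- A correspondence sending each extension `δ ∈ E(Z, A)` to an equivalence class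
`s(δ) = [A ⟶ B ⟶ Z]`. -/
abbrev Correspondence (E : Cᵒᵖ ⥤ C ⥤ AddCommGrpCat.{w}) :=
  ∀ ⦃Z A : C⦄, Ext1 E Z A → SeqClass A Z

/-- `E` is an additive bifunctor. -/
structure IsAdditiveBifunctor [Preadditive C] (E : Cᵒᵖ ⥤ C ⥤ AddCommGrpCat.{w}) : Prop where
  additive_right : ∀ Z : Cᵒᵖ, (E.obj Z).Additive
  additive_left : ∀ A : C, (E.flip.obj A).Additive

variable [Preadditive C] [HasBinaryBiproducts C]

/-- The direct sum `δ ⊕ δ' ∈ E(Z ⊕ Z', A ⊕ A')`, with components `(δ, 0, 0, δ')`. -/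
def extSum (E : Cᵒᵖ ⥤ C ⥤ AddCommGrpCat.{w}) {Z A Z' A' : C} (δ : Ext1 E Z A)
    (δ' : Ext1 E Z' A') : Ext1 E (Z ⊞ Z') (A ⊞ A') :=
  pushExt E biprod.inl (pullExt E biprod.fst δ) + pushExt E biprod.inr (pullExt E biprod.snd δ')

/-- `s` is an additive realization of `E`. -/
structure IsAdditiveRealization (E : Cᵒᵖ ⥤ C ⥤ AddCommGrpCat.{w}) (s : Correspondence E) :
    Prop where
  /-- morphisms of extensions lift to the realizing sequences -/
  realizes : ∀ ⦃A B Z A' B' Z' : C⦄ (δ : Ext1 E Z A) (δ' : Ext1 E Z' A')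
    (x : A ⟶ B) (y : B ⟶ Z) (x' : A' ⟶ B') (y' : B' ⟶ Z') (a : A ⟶ A') (c : Z ⟶ Z'),
    s δ = seqClass x y → s δ' = seqClass x' y' → pushExt E a δ = pullExt E c δ' →
    ∃ b : B ⟶ B', x ≫ b = a ≫ x' ∧ y ≫ c = b ≫ y'
  zero : ∀ Z A : C,
    s (0 : Ext1 E Z A) = seqClass (biprod.inl : A ⟶ A ⊞ Z) (biprod.snd : A ⊞ Z ⟶ Z)
  sum : ∀ ⦃A B Z A' B' Z' : C⦄ (δ : Ext1 E Z A) (δ' : Ext1 E Z' A')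
    (x : A ⟶ B) (y : B ⟶ Z) (x' : A' ⟶ B') (y' : B' ⟶ Z'),
    s δ = seqClass x y → s δ' = seqClass x' y' →
    s (extSum E δ δ') = seqClass (biprod.map x x') (biprod.map y y')

/-- `(C, E, s)` is an extriangulated category (`C` being an additive category). -/
structure IsExtriangulated (E : Cᵒᵖ ⥤ C ⥤ AddCommGrpCat.{w}) (s : Correspondence E) :
    Prop where
  et1 : IsAdditiveBifunctor E
  et2 : IsAdditiveRealization E s
  et3 : ∀ ⦃A B Z A' B' Z' : C⦄ (δ : Ext1 E Z A) (δ' : Ext1 E Z' A')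
    (x : A ⟶ B) (y : B ⟶ Z) (x' : A' ⟶ B') (y' : B' ⟶ Z'),
    s δ = seqClass x y → s δ' = seqClass x' y' →
    ∀ (a : A ⟶ A') (b : B ⟶ B'), x ≫ b = a ≫ x' →
    ∃ c : Z ⟶ Z', pushExt E a δ = pullExt E c δ' ∧ y ≫ c = b ≫ y'
  et3op : ∀ ⦃A B Z A' B' Z' : C⦄ (δ : Ext1 E Z A) (δ' : Ext1 E Z' A')
    (x : A ⟶ B) (y : B ⟶ Z) (x' : A' ⟶ B') (y' : B' ⟶ Z'),
    s δ = seqClass x y → s δ' = seqClass x' y' →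
    ∀ (b : B ⟶ B') (c : Z ⟶ Z'), y ≫ c = b ≫ y' →
    ∃ a : A ⟶ A', pushExt E a δ = pullExt E c δ' ∧ x ≫ b = a ≫ x'
  et4 : ∀ ⦃A B D M F : C⦄ (δ : Ext1 E D A) (δ' : Ext1 E F B)
    (f : A ⟶ B) (f' : B ⟶ D) (g : B ⟶ M) (g' : M ⟶ F),
    s δ = seqClass f f' → s δ' = seqClass g g' →
    ∃ (N : C) (h' : M ⟶ N) (d : D ⟶ N) (e : N ⟶ F) (δ'' : Ext1 E N A),
      s δ'' = seqClass (f ≫ g) h' ∧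
      f' ≫ d = g ≫ h' ∧ h' ≫ e = g' ∧
      s (pushExt E f' δ') = seqClass d e ∧
      pullExt E d δ'' = δ ∧
      pushExt E f δ'' = pullExt E e δ'
  et4op : ∀ ⦃D A B F M : C⦄ (δ : Ext1 E B D) (δ' : Ext1 E M F)
    (f' : D ⟶ A) (f : A ⟶ B) (g' : F ⟶ B) (g : B ⟶ M),
    s δ = seqClass f' f → s δ' = seqClass g' g →
    ∃ (N : C) (h' : N ⟶ A) (d : D ⟶ N) (e : N ⟶ F) (δ'' : Ext1 E M N),
      s δ'' = seqClass h' (f ≫ g) ∧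
      d ≫ h' = f' ∧ h' ≫ f = e ≫ g' ∧
      s (pullExt E g' δ) = seqClass d e ∧
      pushExt E e δ'' = δ' ∧
      pushExt E d δ = pullExt E g δ''

end Extriangulated

/-! ## Exact categories (Quillen) -/

section Exact

variable {C : Type u} [Category.{v} C] [Preadditive C]

/-- A class of composable pairs `A ⟶ B ⟶ Z`. -/
abbrev PairClass (C : Type u) [Category.{v} C] := ∀ ⦃A B Z : C⦄, (A ⟶ B) → (B ⟶ Z) → Prop

/-- Admissible monomorphisms (inflations) of a class of pairs. -/
def AdmMono (S : PairClass C) ⦃A B : C⦄ (i : A ⟶ B) : Prop := ∃ (Z : C) (p : B ⟶ Z), S i p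

/-- Admissible epimorphisms (deflations) of a class of pairs. -/
def AdmEpi (S : PairClass C) ⦃B Z : C⦄ (p : B ⟶ Z) : Prop := ∃ (A : C) (i : A ⟶ B), S i p

/-- `S` is an exact structure in the sense of Quillen on the additive category `C`. -/
structure IsExactStructure (S : PairClass C) : Prop where
  /-- all members are kernel–cokernel pairs -/
  kernel_cokernel : ∀ ⦃A B Z : C⦄ (i : A ⟶ B) (p : B ⟶ Z), S i p →
    ∃ w : i ≫ p = 0, Nonempty (IsLimit (KernelFork.ofι i w)) ∧
      Nonempty (IsColimit (CokernelCofork.ofπ p w))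
  iso_closed : ∀ ⦃A B Z A' B' Z' : C⦄ (i : A ⟶ B) (p : B ⟶ Z) (i' : A' ⟶ B') (p' : B' ⟶ Z')
    (a : A ≅ A') (b : B ≅ B') (c : Z ≅ Z'), i ≫ b.hom = a.hom ≫ i' → p ≫ c.hom = b.hom ≫ p' →
    S i p → S i' p'
  id_mono : ∀ A : C, AdmMono S (𝟙 A)
  id_epi : ∀ A : C, AdmEpi S (𝟙 A)
  comp_mono : ∀ ⦃A B D : C⦄ (i : A ⟶ B) (j : B ⟶ D), AdmMono S i → AdmMono S j →
    AdmMono S (i ≫ j)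
  comp_epi : ∀ ⦃A B D : C⦄ (p : A ⟶ B) (q : B ⟶ D), AdmEpi S p → AdmEpi S q →
    AdmEpi S (p ≫ q)
  pushout : ∀ ⦃A B A' : C⦄ (i : A ⟶ B) (f : A ⟶ A'), AdmMono S i →
    ∃ (B' : C) (b : B ⟶ B') (i' : A' ⟶ B'), IsPushout i f b i' ∧ AdmMono S i'
  pullback : ∀ ⦃B Z Z' : C⦄ (p : B ⟶ Z) (f : Z' ⟶ Z), AdmEpi S p →
    ∃ (B' : C) (p' : B' ⟶ Z') (b : B' ⟶ B), IsPullback p' b f p ∧ AdmEpi S p'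

/-- `(C, E, s)` is an exact category: its conflations, that is, the sequences `A ⟶ B ⟶ Z` realizing
some extension, form an exact structure on `C`. -/
def IsExactCat (E : Cᵒᵖ ⥤ C ⥤ AddCommGrpCat.{w}) (s : Correspondence E) : Prop :=
  IsExactStructure (C := C) (fun A _ Z i p => ∃ δ : Ext1 E Z A, s δ = seqClass i p)

end Exact

/-! ## The extriangulated structure of a triangulated category -/

section Triangulated

variable {C : Type u} [Category.{v} C] [Preadditive C] [HasZeroObject C] [HasShift C ℤ]
  [∀ n : ℤ, (shiftFunctor C n).Additive] [Pretriangulated C]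

/-- The bifunctor `E(Z, A) = Hom(Z, ΣA)`. -/
def triExt (C : Type u) [Category.{v} C] [Preadditive C] [HasShift C ℤ] :
    Cᵒᵖ ⥤ C ⥤ AddCommGrpCat.{v} :=
  preadditiveCoyoneda ⋙ (Functor.whiskeringLeft C C AddCommGrpCat.{v}).obj (shiftFunctor C (1 : ℤ))

/-- Constructor for isomorphisms of triangles. -/
def mkIso {A B Z A' B' Z' : C} {f : A ⟶ B} {g : B ⟶ Z} {h : Z ⟶ A⟦(1 : ℤ)⟧} {f' : A' ⟶ B'}
    {g' : B' ⟶ Z'} {h' : Z' ⟶ A'⟦(1 : ℤ)⟧} (a : A ≅ A') (b : B ≅ B') (c : Z ≅ Z')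
    (h₁ : f ≫ b.hom = a.hom ≫ f') (h₂ : g ≫ c.hom = b.hom ≫ g')
    (h₃ : h ≫ a.hom⟦(1 : ℤ)⟧' = c.hom ≫ h') : Triangle.mk f g h ≅ Triangle.mk f' g' h' :=
  Triangle.isoMk _ _ a b c h₁ h₂ h₃

lemma dist_rot {A B Z : C} {f : A ⟶ B} {g : B ⟶ Z} {h : Z ⟶ A⟦(1 : ℤ)⟧}
    (hT : Triangle.mk f g h ∈ distTriang C) : Triangle.mk g h (-f⟦(1 : ℤ)⟧') ∈ distTriang C :=
  rot_of_distTriang _ hT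

lemma dist_comp {A B Z : C} {f : A ⟶ B} {g : B ⟶ Z} {h : Z ⟶ A⟦(1 : ℤ)⟧}
    (hT : Triangle.mk f g h ∈ distTriang C) : f ≫ g = 0 :=
  comp_distTriang_mor_zero₁₂ _ hT

lemma dist_isoMid {A B B' Z : C} {f : A ⟶ B} {g : B ⟶ Z} {f' : A ⟶ B'} {g' : B' ⟶ Z}
    {h : Z ⟶ A⟦(1 : ℤ)⟧} (hT : Triangle.mk f g h ∈ distTriang C)
    (hT' : Triangle.mk f' g' h ∈ distTriang C) :
    ∃ b : B ≅ B', f ≫ b.hom = f' ∧ b.hom ≫ g' = g := by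
  have key : ∃ b : B ⟶ B', f ≫ b = 𝟙 A ≫ f' ∧ g ≫ 𝟙 Z = b ≫ g' :=
    complete_distinguished_triangle_morphism₂ _ _ hT hT' (𝟙 A) (𝟙 Z)
      (by change h ≫ (shiftFunctor C (1 : ℤ)).map (𝟙 A) = 𝟙 Z ≫ h; simp)
  obtain ⟨b, hb₁, hb₂⟩ := key
  let φ : Triangle.mk f g h ⟶ Triangle.mk f' g' h :=
    { hom₁ := 𝟙 A, hom₂ := b, hom₃ := 𝟙 Z, comm₁ := hb₁, comm₂ := hb₂
      comm₃ := by change h ≫ (shiftFunctor C (1 : ℤ)).map (𝟙 A) = 𝟙 Z ≫ h; simp }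
  have : IsIso b := isIso₂_of_isIso₁₃ φ hT hT' (inferInstanceAs (IsIso (𝟙 A)))
    (inferInstanceAs (IsIso (𝟙 Z)))
  exact ⟨asIso b, by simpa using hb₁, by simpa using hb₂.symm⟩

/-- The realization `s(δ) = [A ⟶ B ⟶ Z]`, where `A ⟶ B ⟶ Z ⟶ ΣA` is any distinguished triangle
with third morphism `δ`. -/
def triSeq {Z A : C} (δ : Z ⟶ A⟦(1 : ℤ)⟧) : SeqClass A Z :=
  seqClass (distinguished_cocone_triangle₂ δ).choose_spec.choose
    (distinguished_cocone_triangle₂ δ).choose_spec.choose_spec.choose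

/-- `A ⟶ B ⟶ Z` realizes `δ` if and only if `A ⟶ B ⟶ Z ⟶ ΣA`, with third morphism `δ`, is
distinguished; in particular `triSeq` does not depend on choices. -/
lemma triSeq_eq_iff {A B Z : C} (x : A ⟶ B) (y : B ⟶ Z) (δ : Z ⟶ A⟦(1 : ℤ)⟧) :
    triSeq δ = seqClass x y ↔ Triangle.mk x y δ ∈ distTriang C := by
  have h := (distinguished_cocone_triangle₂ δ).choose_spec.choose_spec.choose_spec
  unfold triSeq
  rw [seqClass_eq_iff]
  constructor
  · rintro ⟨b, h₁, h₂⟩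
    exact isomorphic_distinguished _ h _ (mkIso (Iso.refl _) b.symm (Iso.refl _)
      (by simp [← h₁]) (by simp [← h₂]) (by simp))
  · intro h'
    exact dist_isoMid h h'

/-- The realization of the bifunctor `Hom(-, Σ-)` by distinguished triangles. -/
def triReal (C : Type u) [Category.{v} C] [Preadditive C] [HasZeroObject C] [HasShift C ℤ]
    [∀ n : ℤ, (shiftFunctor C n).Additive] [Pretriangulated C] : Correspondence (triExt C) :=
  fun Z A δ => triSeq (show Z ⟶ A⟦(1 : ℤ)⟧ from δ)

/-- `(C, E, s)` is a triangulated category: there are a shift and a triangulation on the additive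
category `C` whose associated extriangulated structure is, up to an isomorphism of the bifunctors
compatible with the realizations, `(E, s)`. -/
def IsTriangulatedCat {C : Type u} [Category.{v} C] [Preadditive C] [HasZeroObject C]
    (E : Cᵒᵖ ⥤ C ⥤ AddCommGrpCat.{v}) (s : Correspondence E) : Prop :=
  ∃ (_ : HasShift C ℤ) (_ : ∀ n : ℤ, (shiftFunctor C n).Additive) (_ : Pretriangulated C)
    (_ : IsTriangulated C) (φ : E ≅ triExt C),
    ∀ (Z A : C) (δ : Ext1 E Z A), s δ = triReal C (((φ.hom.app (op Z)).app A).hom δ)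

/-! ## Proper classes of triangles -/

/-- The direct sum of two triangles. -/
def triSum (T T' : Triangle C) : Triangle C :=
  Triangle.mk (biprod.map T.mor₁ T'.mor₁) (biprod.map T.mor₂ T'.mor₂)
    (biprod.fst ≫ T.mor₃ ≫ (biprod.inl : T.obj₁ ⟶ T.obj₁ ⊞ T'.obj₁)⟦(1 : ℤ)⟧' +
      biprod.snd ≫ T'.mor₃ ≫ (biprod.inr : T'.obj₁ ⟶ T.obj₁ ⊞ T'.obj₁)⟦(1 : ℤ)⟧')

/-- The commutative diagram of distinguished triangles
```
  0 ───> M ══════ M ───> 0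
  │     α│       δ│      │
  A ─f'> G ─g'──> E ─h'> ΣA
  ║     β│       ε│      ║
  A ─f─> B ─g───> Z ─h─> ΣA
  │     γ│       ζ│      │
  0 ───> ΣM ═════ ΣM ──> 0
```
expressing that the second row is the base change of the third one along `ε`. -/
structure IsBaseChange {A B Z E G M : C}
    (f : A ⟶ B) (g : B ⟶ Z) (h : Z ⟶ A⟦(1 : ℤ)⟧)
    (f' : A ⟶ G) (g' : G ⟶ E) (h' : E ⟶ A⟦(1 : ℤ)⟧)
    (δ : M ⟶ E) (ε : E ⟶ Z) (ζ : Z ⟶ M⟦(1 : ℤ)⟧)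
    (α : M ⟶ G) (β : G ⟶ B) (γ : B ⟶ M⟦(1 : ℤ)⟧) : Prop where
  row₂ : Triangle.mk f' g' h' ∈ distTriang C
  row₃ : Triangle.mk f g h ∈ distTriang C
  col₂ : Triangle.mk α β γ ∈ distTriang C
  col₃ : Triangle.mk δ ε ζ ∈ distTriang C
  sq₁ : α ≫ g' = δ
  sq₂ : f' ≫ β = f
  sq₃ : g' ≫ ε = β ≫ g
  sq₄ : h' = ε ≫ h
  sq₅ : γ = g ≫ ζ
  sq₆ : δ ≫ h' = 0
  sq₇ : f ≫ γ = 0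

/-- The commutative diagram of distinguished triangles
```
  0 ───> A ─α──> D ─η──> N ─ω──> ΣA
  │     f│     f'│       ║      f│
  0 ───> B ─β──> F ─ϑ──> N ─ω'─> ΣB
  │     g│     g'│       │       │
  0 ───> Z ═════ Z ────> 0 ────> ΣZ
  │     h│     h'│       │       │
  0 ──> ΣA ────> ΣD ───> ΣN ───> ΣΣA
```
(dual to base change) expressing that the second column is the cobase change of the first one
along `α`. -/
structure IsCobaseChange {A B Z D F N : C}
    (f : A ⟶ B) (g : B ⟶ Z) (h : Z ⟶ A⟦(1 : ℤ)⟧)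
    (f' : D ⟶ F) (g' : F ⟶ Z) (h' : Z ⟶ D⟦(1 : ℤ)⟧)
    (α : A ⟶ D) (η : D ⟶ N) (ω : N ⟶ A⟦(1 : ℤ)⟧)
    (β : B ⟶ F) (ϑ : F ⟶ N) (ω' : N ⟶ B⟦(1 : ℤ)⟧) : Prop where
  col₁ : Triangle.mk f g h ∈ distTriang C
  col₂ : Triangle.mk f' g' h' ∈ distTriang C
  row₁ : Triangle.mk α η ω ∈ distTriang C
  row₂ : Triangle.mk β ϑ ω' ∈ distTriang C
  sq₁ : f ≫ β = α ≫ f'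
  sq₂ : β ≫ g' = g
  sq₃ : h' = h ≫ α⟦(1 : ℤ)⟧'
  sq₄ : f' ≫ ϑ = η
  sq₅ : ω' = ω ≫ f⟦(1 : ℤ)⟧'
  sq₆ : h' ≫ η⟦(1 : ℤ)⟧' = 0
  sq₇ : ω' ≫ g⟦(1 : ℤ)⟧' = 0

/-- `ξ` is a proper class of triangles. -/
structure IsProperClass (ξ : Set (Triangle C)) : Prop where
  subset_dist : ξ ⊆ distTriang C
  iso_closed : ∀ T ∈ ξ, ∀ T' : Triangle C, Nonempty (T ≅ T') → T' ∈ ξ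
  /-- closed under finite coproducts (the empty one is a split triangle) -/
  sum_closed : ∀ T ∈ ξ, ∀ T' ∈ ξ, triSum T T' ∈ ξ
  split_mem : ∀ T ∈ distTriang C, T.mor₃ = 0 → T ∈ ξ
  /-- closed under suspensions: `((-1)ⁱ Σⁱf, (-1)ⁱ Σⁱg, (-1)ⁱ Σⁱh)` is in `ξ` for all `i` -/
  shift_closed : ∀ T ∈ ξ, ∀ i : ℤ, (Triangle.shiftFunctor C i).obj T ∈ ξ
  saturated : ∀ ⦃A B Z E G M : C⦄ (f : A ⟶ B) (g : B ⟶ Z) (h : Z ⟶ A⟦(1 : ℤ)⟧)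
    (f' : A ⟶ G) (g' : G ⟶ E) (h' : E ⟶ A⟦(1 : ℤ)⟧)
    (δ : M ⟶ E) (ε : E ⟶ Z) (ζ : Z ⟶ M⟦(1 : ℤ)⟧)
    (α : M ⟶ G) (β : G ⟶ B) (γ : B ⟶ M⟦(1 : ℤ)⟧),
    IsBaseChange f g h f' g' h' δ ε ζ α β γ →
    Triangle.mk δ ε ζ ∈ ξ → Triangle.mk f' g' h' ∈ ξ → Triangle.mk f g h ∈ ξ
  baseChange : ∀ ⦃A B Z E G M : C⦄ (f : A ⟶ B) (g : B ⟶ Z) (h : Z ⟶ A⟦(1 : ℤ)⟧)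
    (f' : A ⟶ G) (g' : G ⟶ E) (h' : E ⟶ A⟦(1 : ℤ)⟧)
    (δ : M ⟶ E) (ε : E ⟶ Z) (ζ : Z ⟶ M⟦(1 : ℤ)⟧)
    (α : M ⟶ G) (β : G ⟶ B) (γ : B ⟶ M⟦(1 : ℤ)⟧),
    IsBaseChange f g h f' g' h' δ ε ζ α β γ →
    Triangle.mk f g h ∈ ξ → Triangle.mk f' g' h' ∈ ξ
  cobaseChange : ∀ ⦃A B Z D F N : C⦄ (f : A ⟶ B) (g : B ⟶ Z) (h : Z ⟶ A⟦(1 : ℤ)⟧)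
    (f' : D ⟶ F) (g' : F ⟶ Z) (h' : Z ⟶ D⟦(1 : ℤ)⟧)
    (α : A ⟶ D) (η : D ⟶ N) (ω : N ⟶ A⟦(1 : ℤ)⟧)
    (β : B ⟶ F) (ϑ : F ⟶ N) (ω' : N ⟶ B⟦(1 : ℤ)⟧),
    IsCobaseChange f g h f' g' h' α η ω β ϑ ω' →
    Triangle.mk f g h ∈ ξ → Triangle.mk f' g' h' ∈ ξ

/-! ## Balanced pairs -/

/-- The triangle `T` is `C(X, -)`-exact: for every `P ∈ X` the map `C(P, A) ⟶ C(P, B)` is injective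
and the map `C(P, B) ⟶ C(P, Z)` is surjective. -/
def IsCovExact (X : ObjectProperty C) (T : Triangle C) : Prop :=
  (∀ P : C, X P → Function.Injective (fun u : P ⟶ T.obj₁ => u ≫ T.mor₁)) ∧
  (∀ P : C, X P → Function.Surjective (fun u : P ⟶ T.obj₂ => u ≫ T.mor₂))

/-- The triangle `T` is `C(-, Y)`-exact: for every `I ∈ Y` the map `C(Z, I) ⟶ C(B, I)` is injective
and the map `C(B, I) ⟶ C(A, I)` is surjective. -/
def IsContraExact (Y : ObjectProperty C) (T : Triangle C) : Prop :=
  (∀ I : C, Y I → Function.Injective (fun u : T.obj₃ ⟶ I => T.mor₂ ≫ u)) ∧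
  (∀ I : C, Y I → Function.Surjective (fun u : T.obj₂ ⟶ I => T.mor₁ ≫ u))

/-- The class `ξ_X` of distinguished triangles that are `C(X, -)`-exact. -/
def xiLower (X : ObjectProperty C) : Set (Triangle C) :=
  {T | T ∈ distTriang C ∧ IsCovExact X T}

/-- The class `ξ^Y` of distinguished triangles that are `C(-, Y)`-exact. -/
def xiUpper (Y : ObjectProperty C) : Set (Triangle C) :=
  {T | T ∈ distTriang C ∧ IsContraExact Y T}

/-- `X` is a `Σ`-stable full additive subcategory closed under direct summands. -/
structure IsStableAdditive (X : ObjectProperty C) : Prop where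
  zero : X.ContainsZero
  sum : X.IsClosedUnderFiniteProducts
  summand : X.IsStableUnderRetracts
  shift : X.IsStableUnderShift ℤ

/-- Every object has a right `X`-approximation. -/
def IsContravariantlyFinite (X : ObjectProperty C) : Prop :=
  ∀ M : C, ∃ (P : C) (f : P ⟶ M), X P ∧
    ∀ P' : C, X P' → Function.Surjective (fun u : P' ⟶ P => u ≫ f)

/-- Every object has a left `Y`-approximation. -/
def IsCovariantlyFinite (Y : ObjectProperty C) : Prop :=
  ∀ M : C, ∃ (I : C) (f : M ⟶ I), Y I ∧
    ∀ I' : C, Y I' → Function.Surjective (fun u : I ⟶ I' => f ≫ u)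

/-- The complex `⋯ ⟶ P 1 ⟶ P 0 ⟶ M` is spliced from triangles `K 0 ⟶ P 0 ⟶ M ⟶ Σ(K 0)` and
`K (n+1) ⟶ P (n+1) ⟶ K n ⟶ Σ(K (n+1))` in `ξ`. -/
def IsExactLeftComplex (ξ : Set (Triangle C)) {M : C} (P : ℕ → C) (d : ∀ n, P (n + 1) ⟶ P n)
    (aug : P 0 ⟶ M) : Prop :=
  ∃ (K : ℕ → C) (g : ∀ n, K n ⟶ P n) (f : ∀ n, P (n + 1) ⟶ K n)
    (h₀ : M ⟶ (K 0)⟦(1 : ℤ)⟧) (h : ∀ n, K n ⟶ (K (n + 1))⟦(1 : ℤ)⟧),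
    Triangle.mk (g 0) aug h₀ ∈ ξ ∧
    ∀ n, Triangle.mk (g (n + 1)) (f n) (h n) ∈ ξ ∧ d n = f n ≫ g n

/-- The complex `N ⟶ I 0 ⟶ I 1 ⟶ ⋯` is spliced from triangles `N ⟶ I 0 ⟶ L 0 ⟶ ΣN` and
`L n ⟶ I (n+1) ⟶ L (n+1) ⟶ Σ(L n)` in `ξ`. -/
def IsExactRightComplex (ξ : Set (Triangle C)) {N : C} (I : ℕ → C) (d : ∀ n, I n ⟶ I (n + 1))
    (aug : N ⟶ I 0) : Prop :=
  ∃ (L : ℕ → C) (f : ∀ n, I n ⟶ L n) (g : ∀ n, L n ⟶ I (n + 1))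
    (h₀ : L 0 ⟶ N⟦(1 : ℤ)⟧) (h : ∀ n, L (n + 1) ⟶ (L n)⟦(1 : ℤ)⟧),
    Triangle.mk aug (f 0) h₀ ∈ ξ ∧
    ∀ n, Triangle.mk (g n) (f (n + 1)) (h n) ∈ ξ ∧ d n = f n ≫ g n

/-- `(X, Y)` is a balanced pair: `X` and `Y` are `Σ`-stable full additive subcategories closed under
direct summands, `X` is contravariantly finite, `Y` is covariantly finite, every object has an
`X`-resolution that is `C(-, Y)`-exact, and every object has a `Y`-coresolution that is
`C(X, -)`-exact. -/
structure IsBalancedPair (X Y : ObjectProperty C) : Prop where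
  stableAdditive_left : IsStableAdditive X
  stableAdditive_right : IsStableAdditive Y
  contravariantlyFinite : IsContravariantlyFinite X
  covariantlyFinite : IsCovariantlyFinite Y
  resolution : ∀ M : C, ∃ (P : ℕ → C) (d : ∀ n, P (n + 1) ⟶ P n) (aug : P 0 ⟶ M),
    (∀ n, X (P n)) ∧ IsExactLeftComplex {T | T ∈ xiLower X ∧ IsContraExact Y T} P d aug
  coresolution : ∀ N : C, ∃ (I : ℕ → C) (d : ∀ n, I n ⟶ I (n + 1)) (aug : N ⟶ I 0),
    (∀ n, Y (I n)) ∧ IsExactRightComplex {T | T ∈ xiUpper Y ∧ IsCovExact X T} I d aug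

/-! ## The relative bifunctor and realization of a proper class -/

/-- The extensions `δ : Z ⟶ ΣA` realized by a triangle `A ⟶ B ⟶ Z ⟶ ΣA` in `ξ`. -/
def relSet (ξ : Set (Triangle C)) (Z A : C) : Set (Z ⟶ A⟦(1 : ℤ)⟧) :=
  {δ | ∃ (B : C) (x : A ⟶ B) (y : B ⟶ Z), triSeq δ = seqClass x y ∧ Triangle.mk x y δ ∈ ξ}

namespace IsProperClass

variable {ξ : Set (Triangle C)}

lemma mem_relSet_iff (hξ : IsProperClass ξ) {A B Z : C} {x : A ⟶ B} {y : B ⟶ Z}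
    {δ : Z ⟶ A⟦(1 : ℤ)⟧} (hT : Triangle.mk x y δ ∈ distTriang C) :
    δ ∈ relSet ξ Z A ↔ Triangle.mk x y δ ∈ ξ := by
  constructor
  · rintro ⟨B', x', y', h₁, h₂⟩
    have h₃ := (triSeq_eq_iff x y δ).2 hT
    rw [h₁, seqClass_eq_iff] at h₃
    obtain ⟨b, hb₁, hb₂⟩ := h₃
    exact hξ.iso_closed _ h₂ _ ⟨mkIso (Iso.refl _) b (Iso.refl _)
      (by simp [hb₁]) (by simp [hb₂]) (by simp)⟩
  · intro h
    exact ⟨B, x, y, (triSeq_eq_iff x y δ).2 hT, h⟩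

lemma zero_mem (hξ : IsProperClass ξ) (Z A : C) : (0 : Z ⟶ A⟦(1 : ℤ)⟧) ∈ relSet ξ Z A := by
  obtain ⟨B, x, y, hT⟩ := distinguished_cocone_triangle₂ (0 : Z ⟶ A⟦(1 : ℤ)⟧)
  exact (hξ.mem_relSet_iff hT).2 (hξ.split_mem _ hT rfl)

lemma pull_mem [IsTriangulated C] (hξ : IsProperClass ξ) {Z Z' A : C} (c : Z' ⟶ Z)
    {δ : Z ⟶ A⟦(1 : ℤ)⟧} (hδ : δ ∈ relSet ξ Z A) : c ≫ δ ∈ relSet ξ Z' A := by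
  obtain ⟨B, f, g, hT⟩ := distinguished_cocone_triangle₂ δ
  obtain ⟨G, f', g', hT'⟩ := distinguished_cocone_triangle₂ (c ≫ δ)
  obtain ⟨M, i, ζ, hM⟩ := distinguished_cocone_triangle₁ c
  rw [hξ.mem_relSet_iff hT] at hδ
  rw [hξ.mem_relSet_iff hT']
  let o := Triangulated.someOctahedron' (rfl : c ≫ δ = c ≫ δ) hM
    (dist_rot hT) (dist_rot hT')
  refine hξ.baseChange f g δ f' g' (c ≫ δ) i c ζ o.m₁ o.m₃ (g ≫ ζ) ?_ hδ
  exact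
    { row₂ := hT'
      row₃ := hT
      col₂ := o.mem
      col₃ := hM
      sq₁ := o.comm₁
      sq₂ := by
        have := o.comm₃
        apply (shiftFunctor C (1 : ℤ)).map_injective
        simpa [Functor.map_comp, Functor.map_neg, Preadditive.neg_comp, Preadditive.comp_neg]
          using this
      sq₃ := o.comm₄.symm
      sq₄ := rfl
      sq₅ := rfl
      sq₆ := by
        rw [← Category.assoc, dist_comp hM, zero_comp]
      sq₇ := by
        rw [← Category.assoc, dist_comp hT, zero_comp] }

lemma push_mem [IsTriangulated C] (hξ : IsProperClass ξ) {Z A A' : C} (a : A ⟶ A')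
    {δ : Z ⟶ A⟦(1 : ℤ)⟧} (hδ : δ ∈ relSet ξ Z A) : δ ≫ a⟦(1 : ℤ)⟧' ∈ relSet ξ Z A' := by
  obtain ⟨B, f, g, hT⟩ := distinguished_cocone_triangle₂ δ
  obtain ⟨F, f', g', hT'⟩ := distinguished_cocone_triangle₂ (δ ≫ a⟦(1 : ℤ)⟧')
  obtain ⟨N, η, ω, hN⟩ := distinguished_cocone_triangle a
  rw [hξ.mem_relSet_iff hT] at hδ
  rw [hξ.mem_relSet_iff hT']
  have hN' : Triangle.mk ω (a⟦(1 : ℤ)⟧') (η⟦(1 : ℤ)⟧') ∈ distTriang C := by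
    refine isomorphic_distinguished _ (dist_rot (dist_rot hN)) _ ?_
    refine mkIso (Iso.refl _) (Iso.refl _) (-(Iso.refl _)) ?_ ?_ ?_
    · simp
    · simp
    · simp
  let o := Triangulated.someOctahedron' (rfl : δ ≫ a⟦(1 : ℤ)⟧' = δ ≫ a⟦(1 : ℤ)⟧')
    (dist_rot hT) hN' (dist_rot hT')
  refine hξ.cobaseChange f g δ f' g' (δ ≫ a⟦(1 : ℤ)⟧') a η ω o.m₁ (-o.m₃) (ω ≫ f⟦(1 : ℤ)⟧') ?_ hδ
  exact
    { col₁ := hT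
      col₂ := hT'
      row₁ := hN
      row₂ := by
        refine isomorphic_distinguished _ o.mem _ ?_
        refine mkIso (Iso.refl _) (Iso.refl _) (-(Iso.refl _)) ?_ ?_ ?_
        · simp
        · simp
        · simp
      sq₁ := by
        have := o.comm₂
        apply (shiftFunctor C (1 : ℤ)).map_injective
        simpa [Functor.map_comp, Functor.map_neg, Preadditive.neg_comp, Preadditive.comp_neg]
          using this
      sq₂ := o.comm₁
      sq₃ := rfl
      sq₄ := by
        have := o.comm₃
        apply (shiftFunctor C (1 : ℤ)).map_injective
        simpa [Functor.map_comp, Functor.map_neg, Preadditive.neg_comp, Preadditive.comp_neg]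
          using this
      sq₅ := rfl
      sq₆ := by
        rw [Category.assoc, ← Functor.map_comp, dist_comp hN, Functor.map_zero, comp_zero]
      sq₇ := by
        rw [Category.assoc, ← Functor.map_comp, dist_comp hT, Functor.map_zero, comp_zero] }

lemma add_mem [IsTriangulated C] (hξ : IsProperClass ξ) {Z A : C}
    {δ δ' : Z ⟶ A⟦(1 : ℤ)⟧} (hδ : δ ∈ relSet ξ Z A) (hδ' : δ' ∈ relSet ξ Z A) :
    δ + δ' ∈ relSet ξ Z A := by
  obtain ⟨B, f, g, -, h⟩ := hδ
  obtain ⟨B', f', g', -, h'⟩ := hδ'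
  have hs := hξ.sum_closed _ h _ h'
  have hs' : biprod.fst ≫ δ ≫ (biprod.inl : A ⟶ A ⊞ A)⟦(1 : ℤ)⟧' +
      biprod.snd ≫ δ' ≫ (biprod.inr : A ⟶ A ⊞ A)⟦(1 : ℤ)⟧' ∈ relSet ξ (Z ⊞ Z) (A ⊞ A) :=
    (hξ.mem_relSet_iff (hξ.subset_dist hs)).2 hs
  have := hξ.push_mem (biprod.desc (𝟙 A) (𝟙 A)) (hξ.pull_mem (biprod.lift (𝟙 Z) (𝟙 Z)) hs')
  convert this using 1
  simp [← Functor.map_comp]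

lemma neg_mem [IsTriangulated C] (hξ : IsProperClass ξ) {Z A : C}
    {δ : Z ⟶ A⟦(1 : ℤ)⟧} (hδ : δ ∈ relSet ξ Z A) : -δ ∈ relSet ξ Z A := by
  simpa using hξ.pull_mem (-𝟙 Z) hδ

end IsProperClass

variable [IsTriangulated C] {ξ : Set (Triangle C)}

/-- `E_ξ(Z, A)`, the subgroup of `E(Z, A) = Hom(Z, ΣA)` of those extensions that are realized by a
triangle in `ξ`. -/
def relSubgroup (hξ : IsProperClass ξ) (Z A : C) : AddSubgroup (Z ⟶ A⟦(1 : ℤ)⟧) where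
  carrier := relSet ξ Z A
  zero_mem' := hξ.zero_mem Z A
  add_mem' := hξ.add_mem
  neg_mem' := hξ.neg_mem

/-- The bifunctor `E_ξ`, the restriction of `E = Hom(-, Σ-)` to `ξ`. -/
def relExt (hξ : IsProperClass ξ) : Cᵒᵖ ⥤ C ⥤ AddCommGrpCat.{v} where
  obj Z :=
    { obj := fun A => AddCommGrpCat.of (relSubgroup hξ Z.unop A)
      map := fun a => AddCommGrpCat.ofHom
        { toFun := fun δ => ⟨δ.1 ≫ a⟦(1 : ℤ)⟧', hξ.push_mem a δ.2⟩
          map_zero' := by ext; simp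
          map_add' := by intros; ext; simp }
      map_id := by intro A; ext δ; simp
      map_comp := by intro A A' A'' a a'; ext δ; simp }
  map c :=
    { app := fun A => AddCommGrpCat.ofHom
        { toFun := fun δ => ⟨c.unop ≫ δ.1, hξ.pull_mem c.unop δ.2⟩
          map_zero' := by ext; simp
          map_add' := by intros; ext; simp }
      naturality := by intro A A' a; ext δ; simp }
  map_id := by intro Z; ext A δ; simp
  map_comp := by intro Z Z' Z'' c c'; ext A δ; simp

/-- The correspondence `s_ξ`, the restriction of `s` to `E_ξ`. -/
def relReal (hξ : IsProperClass ξ) : Correspondence (relExt hξ) :=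
  fun Z A δ => triSeq (show relSubgroup hξ Z A from δ).1

end Triangulated

end

end RelTri

/-! Everything is read off the third morphism of a triangle. Call `δ : Z ⟶ W` an `X`-ghost if every
map from `X` to `Z` composes to zero with it, and a `Y`-coghost dually. By `Σ`-stability and the
long exact Hom sequences, `ξ_X` consists of the distinguished triangles whose third morphism is a
ghost (`mem_xiLower_iff`), and `ξ^Y` of those where it is a coghost (`mem_xiUpper_iff`). For a
balanced pair the two conditions agree on maps `Z ⟶ ΣA` (`isGhost_iff_isCoghost`): a ghost factors
through the connecting map of a resolution triangle, which is a coghost, and conversely with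
coresolutions.

Ghosts form a two-sided ideal stable under `Σ`, which gives the closure properties of a proper
class. The octahedral axiom supplies the diagrams of ET4, and it remains to see that the new
extension is again a ghost (`isExtriangulated_xiLower`).

Objects of `X` are projective and objects of `Y` injective for `E_ξ`. If `E_ξ` is `Hom(-, Σ'-)` for
some suspension, such objects must vanish. If the structure is exact, inflations are monic, so all
triangles of `ξ` split and every object is a summand of one in `X` and of one in `Y`. -/

namespace RelTri

/-! ### Closure properties of `Σ`-stable additive subcategories. -/

namespace IsStableAdditive

variable {C : Type u} [Category.{v} C] [HasShift C ℤ] {X : ObjectProperty C}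

lemma shift_mem (hX : IsStableAdditive X) {P : C} (hP : X P) (n : ℤ) : X (P⟦n⟧) :=
  have := hX.shift
  X.le_shift n P hP

lemma retract_mem (hX : IsStableAdditive X) {P Q : C} (r : Retract P Q) (hQ : X Q) : X P :=
  have := hX.summand
  X.prop_of_retract r hQ

lemma isZero_mem (hX : IsStableAdditive X) {P : C} (hP : IsZero P) : X P :=
  have := hX.summand
  have := hX.zero
  X.prop_of_isZero hP

lemma eq_isZero (hX : IsStableAdditive X) (h : ∀ P, X P → IsZero P) :
    X = fun A => IsZero A := by
  ext P
  exact ⟨h P, hX.isZero_mem⟩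

end IsStableAdditive

/-! ### Objects with vanishing extension groups, for an arbitrary shift. -/

section

variable {C : Type u} [Category.{v} C] [Preadditive C] [HasShift C ℤ]

lemma subsingleton_hom_shift {E : Cᵒᵖ ⥤ C ⥤ AddCommGrpCat.{v}} (φ : E ≅ triExt C) {Z A : C}
    (h : Subsingleton (Ext1 E Z A)) : Subsingleton (Z ⟶ A⟦(1 : ℤ)⟧) :=
  (((φ.app (op Z)).app A).addCommGroupIsoToAddEquiv.symm.toEquiv).subsingleton

/-- Take `A = Σ⁻¹P`: the identity of `P` then lies, up to isomorphism, in a trivial group. No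
triangulation is assumed, so that the lemma applies to the unknown suspension in
`IsTriangulatedCat`. -/
lemma isZero_of_subsingleton_hom_to_shift {P : C}
    (h : ∀ A : C, Subsingleton (P ⟶ A⟦(1 : ℤ)⟧)) : IsZero P := by
  let e := (shiftFunctorCompIsoId C (-1 : ℤ) 1 (by simp)).app P
  rw [IsZero.iff_id_eq_zero, ← cancel_mono e.inv]
  exact (h _).elim _ _

lemma isZero_of_subsingleton_hom_from_all {I : C}
    (h : ∀ Z : C, Subsingleton (Z ⟶ I⟦(1 : ℤ)⟧)) : IsZero I := by
  rw [IsZero.iff_id_eq_zero]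
  exact (shiftFunctor C (1 : ℤ)).map_injective ((h _).elim _ _)

end

/-! ### Ghosts and coghosts. -/

section

variable {C : Type u} [Category.{v} C] [Preadditive C]

/-- The morphism `δ` vanishes on precomposition with every morphism from an object in `X`. -/
def IsGhost (X : ObjectProperty C) {Z W : C} (δ : Z ⟶ W) : Prop :=
  ∀ P : C, X P → ∀ u : P ⟶ Z, u ≫ δ = 0

/-- The morphism `δ` vanishes on postcomposition with every morphism to an object in `Y`. -/
def IsCoghost (Y : ObjectProperty C) {Z W : C} (δ : Z ⟶ W) : Prop :=
  ∀ I : C, Y I → ∀ w : W ⟶ I, δ ≫ w = 0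

lemma IsGhost.shift [HasShift C ℤ]
    [∀ n : ℤ, (shiftFunctor C n).Additive] {X : ObjectProperty C} (hX : IsStableAdditive X) {Z W : C}
    {δ : Z ⟶ W} (hδ : IsGhost X δ) (n : ℤ) : IsGhost X (δ⟦n⟧') := by
  intro P hP u
  let e := (shiftFunctorCompIsoId C (-n) n (by simp)).app P
  -- The shift is full, so `u` is, up to `P ≅ P⟦-n⟧⟦n⟧`, the shift of a map out of `P⟦-n⟧`, again an
  -- object of `X`.
  obtain ⟨u', hu'⟩ := (shiftFunctor C n).map_surjective (e.hom ≫ u)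
  have := hδ _ (hX.shift_mem hP (-n)) u'
  rw [← cancel_epi e.hom, ← Category.assoc]
  erw [← hu']
  rw [← Functor.map_comp, this, Functor.map_zero, comp_zero]

end

/-! ### Exact triangles in terms of their third morphism, and the proper class axioms. -/

section Ghost

variable {C : Type u} [Category.{v} C] [Preadditive C] [HasZeroObject C] [HasShift C ℤ]
  [∀ n : ℤ, (shiftFunctor C n).Additive] [Pretriangulated C]

section

variable {A B Z W : C} {f : A ⟶ B} {g : B ⟶ Z} {h : Z ⟶ A⟦(1 : ℤ)⟧}

lemma dist_factor_mor₃_left (hT : Triangle.mk f g h ∈ distTriang C) (w : Z ⟶ W)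
    (hw : g ≫ w = 0) : ∃ t : A⟦(1 : ℤ)⟧ ⟶ W, w = h ≫ t :=
  Triangle.yoneda_exact₃ _ hT w hw

lemma dist_factor_mor₂ (hT : Triangle.mk f g h ∈ distTriang C) (u : W ⟶ Z)
    (hu : u ≫ h = 0) : ∃ t : W ⟶ B, u = t ≫ g :=
  Triangle.coyoneda_exact₃ _ hT u hu

lemma dist_factor_mor₃_right (hT : Triangle.mk f g h ∈ distTriang C) (u : W ⟶ A⟦(1 : ℤ)⟧)
    (hu : u ≫ f⟦(1 : ℤ)⟧' = 0) : ∃ t : W ⟶ Z, u = t ≫ h :=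
  Triangle.coyoneda_exact₁ _ hT u hu

end

/-- Surjectivity of `C(P, g)` is the vanishing of `C(P, h)`. Injectivity of `C(P, f)` is the same
vanishing for `ΣP`, so it costs nothing when `X` is `Σ`-stable. -/
lemma mem_xiLower_iff {X : ObjectProperty C} (hX : IsStableAdditive X) (T : Triangle C) :
    T ∈ xiLower X ↔ T ∈ distTriang C ∧ IsGhost X T.mor₃ := by
  refine ⟨fun h => ⟨h.1, fun P hP u => ?_⟩, fun h => ⟨h.1, fun P hP => ?_, fun P hP u => ?_⟩⟩
  · obtain ⟨u', rfl⟩ := h.2.2 P hP u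
    simp [comp_distTriang_mor_zero₂₃ T h.1]
  · intro u u' huu'
    have hz : (u - u') ≫ T.mor₁ = 0 := by
      rw [Preadditive.sub_comp, sub_eq_zero]
      exact huu'
    obtain ⟨t, ht⟩ := T.coyoneda_exact₁ h.1 ((u - u')⟦(1 : ℤ)⟧')
      (by rw [← Functor.map_comp, hz, Functor.map_zero])
    rw [h.2 _ (hX.shift_mem hP 1) t] at ht
    exact sub_eq_zero.1 ((shiftFunctor C (1 : ℤ)).map_injective (by rw [ht, Functor.map_zero]))
  · obtain ⟨t, ht⟩ := T.coyoneda_exact₃ h.1 u (h.2 P hP u)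
    exact ⟨t, ht.symm⟩

lemma mem_xiUpper_iff {Y : ObjectProperty C} (hY : IsStableAdditive Y) (T : Triangle C) :
    T ∈ xiUpper Y ↔ T ∈ distTriang C ∧ IsCoghost Y T.mor₃ := by
  refine ⟨fun h => ⟨h.1, fun I hI w => ?_⟩, fun h => ⟨h.1, fun I hI => ?_, fun I hI v => ?_⟩⟩
  · refine h.2.1 I hI ?_
    simp only [comp_zero]
    rw [← Category.assoc, comp_distTriang_mor_zero₂₃ T h.1, zero_comp]
  · intro w w' hww'
    obtain ⟨t, ht⟩ := T.yoneda_exact₃ h.1 (w - w') (by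
      rw [Preadditive.comp_sub, sub_eq_zero]
      exact hww')
    rw [h.2 I hI t] at ht
    exact sub_eq_zero.1 ht
  · obtain ⟨t, ht⟩ := T.rotate.yoneda_exact₃ (rot_of_distTriang _ h.1) (v⟦(1 : ℤ)⟧')
      (h.2 _ (hY.shift_mem hI 1) _)
    obtain ⟨t' : T.obj₂ ⟶ I, rfl⟩ := (shiftFunctor C (1 : ℤ)).map_surjective t
    -- The sign compensates the `-Σf` in the rotated triangle.
    refine ⟨-t', (shiftFunctor C (1 : ℤ)).map_injective ?_⟩
    rw [ht]
    change (shiftFunctor C (1 : ℤ)).map (T.mor₁ ≫ (-t')) =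
      (-T.mor₁⟦(1 : ℤ)⟧') ≫ t'⟦(1 : ℤ)⟧'
    rw [Preadditive.comp_neg, Functor.map_neg, Functor.map_comp, Preadditive.neg_comp]

lemma mk_mem_xiLower_iff {X : ObjectProperty C} (hX : IsStableAdditive X) {A B Z : C}
    {f : A ⟶ B} {g : B ⟶ Z} {h : Z ⟶ A⟦(1 : ℤ)⟧} :
    Triangle.mk f g h ∈ xiLower X ↔ Triangle.mk f g h ∈ distTriang C ∧ IsGhost X h :=
  mem_xiLower_iff hX _

lemma mk_mem_xiUpper_iff {Y : ObjectProperty C} (hY : IsStableAdditive Y) {A B Z : C}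
    {f : A ⟶ B} {g : B ⟶ Z} {h : Z ⟶ A⟦(1 : ℤ)⟧} :
    Triangle.mk f g h ∈ xiUpper Y ↔ Triangle.mk f g h ∈ distTriang C ∧ IsCoghost Y h :=
  mem_xiUpper_iff hY _

/-- Only the first triangle of a (co)resolution is needed. A ghost kills `P 0 ⟶ Z`, so it factors
through `Z ⟶ Σ(K 0)`, a coghost because the triangle is `C(-, Y)`-exact. Dually, a coghost is killed
by `ΣA ⟶ Σ(I 0)`, so it factors through the ghost `L 0 ⟶ ΣA`. -/
lemma isGhost_iff_isCoghost {X Y : ObjectProperty C} (h : IsBalancedPair X Y) {Z A : C}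
    (δ : Z ⟶ A⟦(1 : ℤ)⟧) : IsGhost X δ ↔ IsCoghost Y δ := by
  have hX := h.stableAdditive_left
  have hY := h.stableAdditive_right
  constructor
  · intro hδ I hI w
    obtain ⟨P, d, aug, hP, K, g, f, h₀, -, hT, -⟩ := h.resolution Z
    obtain ⟨t, rfl⟩ := dist_factor_mor₃_left hT.1.1 δ (hδ _ (hP 0) aug)
    have := ((mk_mem_xiUpper_iff hY).1 ⟨hT.1.1, hT.2⟩).2 I hI (t ≫ w)
    simpa using this
  · intro hδ P hP u
    obtain ⟨I, d, aug, hI, L, f, g, h₀, -, hT, -⟩ := h.coresolution A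
    obtain ⟨t, rfl⟩ := dist_factor_mor₃_right hT.1.1 δ
      (hδ _ (hY.shift_mem (hI 0) 1) (aug⟦(1 : ℤ)⟧'))
    have := ((mk_mem_xiLower_iff hX).1 ⟨hT.1.1, hT.2⟩).2 P hP (u ≫ t)
    simpa using this

theorem xiLower_eq_xiUpper {X Y : ObjectProperty C} (h : IsBalancedPair X Y) :
    xiLower X = xiUpper Y := by
  ext T
  rw [mem_xiLower_iff h.stableAdditive_left, mem_xiUpper_iff h.stableAdditive_right,
    isGhost_iff_isCoghost h]

/-- The projection of a direct sum of triangles to the first summand. -/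
noncomputable def triSumFst (T T' : Triangle C) : triSum T T' ⟶ T where
  hom₁ := biprod.fst
  hom₂ := biprod.fst
  hom₃ := biprod.fst
  comm₁ := biprod.map_fst _ _
  comm₂ := biprod.map_fst _ _
  comm₃ := by
    change (biprod.fst ≫ T.mor₃ ≫ (biprod.inl : T.obj₁ ⟶ T.obj₁ ⊞ T'.obj₁)⟦(1 : ℤ)⟧' +
      biprod.snd ≫ T'.mor₃ ≫ (biprod.inr : T'.obj₁ ⟶ T.obj₁ ⊞ T'.obj₁)⟦(1 : ℤ)⟧') ≫
        (biprod.fst : T.obj₁ ⊞ T'.obj₁ ⟶ T.obj₁)⟦(1 : ℤ)⟧' = biprod.fst ≫ T.mor₃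
    simp [← Functor.map_comp]

/-- The projection of a direct sum of triangles to the second summand. -/
noncomputable def triSumSnd (T T' : Triangle C) : triSum T T' ⟶ T' where
  hom₁ := biprod.snd
  hom₂ := biprod.snd
  hom₃ := biprod.snd
  comm₁ := biprod.map_snd _ _
  comm₂ := biprod.map_snd _ _
  comm₃ := by
    change (biprod.fst ≫ T.mor₃ ≫ (biprod.inl : T.obj₁ ⟶ T.obj₁ ⊞ T'.obj₁)⟦(1 : ℤ)⟧' +
      biprod.snd ≫ T'.mor₃ ≫ (biprod.inr : T'.obj₁ ⟶ T.obj₁ ⊞ T'.obj₁)⟦(1 : ℤ)⟧') ≫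
        (biprod.snd : T.obj₁ ⊞ T'.obj₁ ⟶ T'.obj₁)⟦(1 : ℤ)⟧' = biprod.snd ≫ T'.mor₃
    simp [← Functor.map_comp]

/-- Compares a biproduct with a product over `Bool`; used on each of the three components to deduce
`triSum_distinguished` from the case of product triangles. -/
lemma isIso_piLift_biprod (F : Bool → C) [HasProduct F]
    (φ : ∀ j, F true ⊞ F false ⟶ F j) (h₁ : φ true = biprod.fst) (h₂ : φ false = biprod.snd) :
    IsIso (Pi.lift φ) := by
  refine ⟨biprod.lift (Pi.π F true) (Pi.π F false), ?_, ?_⟩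
  · ext <;> simp [h₁, h₂]
  · refine Pi.hom_ext _ _ ?_
    rintro (_ | _) <;> simp [h₁, h₂]

lemma triSum_distinguished {T T' : Triangle C} (hT : T ∈ distTriang C) (hT' : T' ∈ distTriang C) :
    triSum T T' ∈ distTriang C := by
  let F : Bool → Triangle C := fun j => bif j then T else T'
  let φ : ∀ j, triSum T T' ⟶ F j := fun j => match j with
    | true => triSumFst T T'
    | false => triSumSnd T T'
  have hF : ∀ j, F j ∈ distTriang C := by
    rintro (_ | _)
    · exact hT'
    · exact hT
  refine isomorphic_distinguished _ (productTriangle_distinguished F hF) _ ?_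
  have h₁ : IsIso (productTriangle.lift F φ).hom₁ :=
    isIso_piLift_biprod (fun j => (F j).obj₁) (fun j => (φ j).hom₁) rfl rfl
  have h₂ : IsIso (productTriangle.lift F φ).hom₂ :=
    isIso_piLift_biprod (fun j => (F j).obj₂) (fun j => (φ j).hom₂) rfl rfl
  have h₃ : IsIso (productTriangle.lift F φ).hom₃ :=
    isIso_piLift_biprod (fun j => (F j).obj₃) (fun j => (φ j).hom₃) rfl rfl
  have := Triangle.isIso_of_isIsos _ h₁ h₂ h₃
  exact asIso (productTriangle.lift F φ)

theorem isProperClass_xiLower {X : ObjectProperty C} (hX : IsStableAdditive X) :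
    IsProperClass (xiLower X) where
  subset_dist := fun _ hT => hT.1
  iso_closed := by
    rintro T hT T' ⟨e⟩
    rw [mem_xiLower_iff hX] at hT ⊢
    refine ⟨isomorphic_distinguished _ hT.1 _ e.symm, fun P hP u => ?_⟩
    have h := hT.2 P hP (u ≫ e.inv.hom₃)
    rw [Category.assoc] at h
    have hc := e.inv.comm₃
    rw [← cancel_mono (e.inv.hom₁⟦(1 : ℤ)⟧'), Category.assoc, hc, h, zero_comp]
  sum_closed := by
    intro T hT T' hT'
    rw [mem_xiLower_iff hX] at hT hT' ⊢
    refine ⟨triSum_distinguished hT.1 hT'.1, fun P hP (u : P ⟶ T.obj₃ ⊞ T'.obj₃) => ?_⟩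
    have h : u ≫ (biprod.fst : T.obj₃ ⊞ T'.obj₃ ⟶ _) ≫ T.mor₃ = 0 := by
      simpa using hT.2 P hP (u ≫ biprod.fst)
    have h' : u ≫ (biprod.snd : T.obj₃ ⊞ T'.obj₃ ⟶ _) ≫ T'.mor₃ = 0 := by
      simpa using hT'.2 P hP (u ≫ biprod.snd)
    have : u ≫ (biprod.fst ≫ T.mor₃ ≫ (biprod.inl : T.obj₁ ⟶ T.obj₁ ⊞ T'.obj₁)⟦(1 : ℤ)⟧' +
        biprod.snd ≫ T'.mor₃ ≫ (biprod.inr : T'.obj₁ ⟶ T.obj₁ ⊞ T'.obj₁)⟦(1 : ℤ)⟧') = 0 := by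
      simp [reassoc_of% h, reassoc_of% h']
    exact this
  split_mem := by
    intro T hT h
    rw [mem_xiLower_iff hX]
    exact ⟨hT, fun P hP u => by rw [h, comp_zero]⟩
  shift_closed := by
    intro T hT i
    rw [mem_xiLower_iff hX] at hT ⊢
    refine ⟨Triangle.shift_distinguished _ hT.1 i, fun P hP (u : P ⟶ T.obj₃⟦i⟧) => ?_⟩
    have h := hT.2.shift hX i P hP u
    -- The third morphism of the shifted triangle is the shifted one up to a sign and an
    -- isomorphism, neither of which affects being a ghost.
    change u ≫ (i.negOnePow • T.mor₃⟦i⟧' ≫ (shiftFunctorComm C 1 i).hom.app T.obj₁) = 0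
    rw [Linear.comp_units_smul, reassoc_of% h, zero_comp, smul_zero]
  saturated := by
    intro A B Z E G M f g h f' g' h' δ ε ζ α β γ hb hδ hh'
    rw [mk_mem_xiLower_iff hX] at hδ hh' ⊢
    refine ⟨hb.row₃, fun P hP u => ?_⟩
    -- As `ζ` is a ghost, `u` lifts along `ε`; then `u ≫ h` becomes `t ≫ h'`, which vanishes as `h'`
    -- is a ghost.
    obtain ⟨t, rfl⟩ := dist_factor_mor₂ hb.col₃ u (hδ.2 P hP u)
    have := hh'.2 P hP t
    simpa [hb.sq₄] using this
  baseChange := by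
    intro A B Z E G M f g h f' g' h' δ ε ζ α β γ hb hh
    rw [mk_mem_xiLower_iff hX] at hh ⊢
    refine ⟨hb.row₂, fun P hP u => ?_⟩
    have := hh.2 P hP (u ≫ ε)
    simpa [hb.sq₄] using this
  cobaseChange := by
    intro A B Z D F N f g h f' g' h' α η ω β ϑ ω' hb hh
    rw [mk_mem_xiLower_iff hX] at hh ⊢
    refine ⟨hb.col₂, fun P hP u => ?_⟩
    have := hh.2 P hP u
    simp [hb.sq₃, reassoc_of% this]

lemma mem_relSet_xiLower_iff {X : ObjectProperty C} (hX : IsStableAdditive X) {Z A : C}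
    (δ : Z ⟶ A⟦(1 : ℤ)⟧) : δ ∈ relSet (xiLower X) Z A ↔ IsGhost X δ := by
  obtain ⟨B, x, y, hT⟩ := distinguished_cocone_triangle₂ δ
  rw [(isProperClass_xiLower hX).mem_relSet_iff hT, mk_mem_xiLower_iff hX]
  exact ⟨fun h => h.2, fun h => ⟨hT, h⟩⟩

end Ghost

/-! ### The relative extriangulated structure. -/

section Relative

variable {C : Type u} [Category.{v} C] [Preadditive C] [HasZeroObject C] [HasShift C ℤ]
  [∀ n : ℤ, (shiftFunctor C n).Additive] [Pretriangulated C] [IsTriangulated C]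
  {ξ : Set (Triangle C)}

/-- The morphism underlying a relative extension. -/
def relVal {hξ : IsProperClass ξ} {Z A : C} (δ : Ext1 (relExt hξ) Z A) : Z ⟶ A⟦(1 : ℤ)⟧ :=
  (show relSubgroup hξ Z A from δ).1

/-- The relative extension given by an element of `relSet`. -/
def relMk (hξ : IsProperClass ξ) {Z A : C} {δ : Z ⟶ A⟦(1 : ℤ)⟧} (hδ : δ ∈ relSet ξ Z A) :
    Ext1 (relExt hξ) Z A :=
  (⟨δ, hδ⟩ : relSubgroup hξ Z A)

section

variable {hξ : IsProperClass ξ}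

lemma relVal_mem {Z A : C} (δ : Ext1 (relExt hξ) Z A) : relVal δ ∈ relSet ξ Z A :=
  (show relSubgroup hξ Z A from δ).2

lemma relVal_injective {Z A : C} {δ δ' : Ext1 (relExt hξ) Z A} (h : relVal δ = relVal δ') :
    δ = δ' :=
  Subtype.ext (p := fun x => x ∈ relSubgroup hξ Z A) h

lemma relVal_push {Z A A' : C} (a : A ⟶ A') (δ : Ext1 (relExt hξ) Z A) :
    relVal (pushExt (relExt hξ) a δ) = relVal δ ≫ a⟦(1 : ℤ)⟧' :=
  rfl

lemma relVal_pull {Z Z' A : C} (c : Z' ⟶ Z) (δ : Ext1 (relExt hξ) Z A) :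
    relVal (pullExt (relExt hξ) c δ) = c ≫ relVal δ :=
  rfl

lemma relVal_add {Z A : C} (δ δ' : Ext1 (relExt hξ) Z A) :
    relVal (δ + δ') = relVal δ + relVal δ' :=
  rfl

lemma relReal_eq_iff {A B Z : C} (x : A ⟶ B) (y : B ⟶ Z) (δ : Ext1 (relExt hξ) Z A) :
    relReal hξ δ = seqClass x y ↔ Triangle.mk x y (relVal δ) ∈ distTriang C :=
  triSeq_eq_iff x y (relVal δ)

end

lemma isAdditiveBifunctor_relExt (hξ : IsProperClass ξ) : IsAdditiveBifunctor (relExt hξ) where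
  additive_right Z :=
    { map_add := by
        intro A A' a a'
        ext δ
        refine relVal_injective (hξ := hξ) ?_
        change relVal (pushExt _ (a + a') δ) = relVal (pushExt _ a δ) + relVal (pushExt _ a' δ)
        simp [relVal_push, Functor.map_add] }
  additive_left A :=
    { map_add := by
        intro Z Z' c c'
        ext δ
        refine relVal_injective (hξ := hξ) ?_
        change relVal (pullExt _ (c.unop + c'.unop) δ) =
          relVal (pullExt _ c.unop δ) + relVal (pullExt _ c'.unop δ)
        simp [relVal_pull] }

lemma isAdditiveRealization_relReal (hξ : IsProperClass ξ) :
    IsAdditiveRealization (relExt hξ) (relReal hξ) where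
  realizes := by
    intro A B Z A' B' Z' δ δ' x y x' y' a c h h' hac
    rw [relReal_eq_iff] at h h'
    exact complete_distinguished_triangle_morphism₂ _ _ h h' a c (congrArg relVal hac)
  zero Z A := by
    rw [relReal_eq_iff]
    exact binaryBiproductTriangle_distinguished A Z
  sum := by
    intro A B Z A' B' Z' δ δ' x y x' y' h h'
    rw [relReal_eq_iff] at h h' ⊢
    convert triSum_distinguished h h' using 1
    simp only [extSum, relVal_add, relVal_push, relVal_pull, Category.assoc]
    rfl

/-- The relative structure of a proper class `ξ` is extriangulated as soon as the class is closed
under the composites of inflations and of deflations. -/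
lemma isExtriangulated_of_comp (hξ : IsProperClass ξ)
    (hmono : ∀ ⦃A B D F N : C⦄ (f : A ⟶ B) (f' : B ⟶ D) (δ : D ⟶ A⟦(1 : ℤ)⟧)
      (_ : Triangle.mk f f' δ ∈ distTriang C) (e : N ⟶ F) (δ' : F ⟶ B⟦(1 : ℤ)⟧)
      (δ'' : N ⟶ A⟦(1 : ℤ)⟧), δ ∈ relSet ξ D A → δ' ∈ relSet ξ F B →
      δ'' ≫ f⟦(1 : ℤ)⟧' = e ≫ δ' → δ'' ∈ relSet ξ N A)
    (hepi : ∀ ⦃D B M F N : C⦄ (g' : F ⟶ B) (g : B ⟶ M) (δ' : M ⟶ F⟦(1 : ℤ)⟧)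
      (_ : Triangle.mk g' g δ' ∈ distTriang C) (d : D ⟶ N) (δ : B ⟶ D⟦(1 : ℤ)⟧)
      (δ'' : M ⟶ N⟦(1 : ℤ)⟧), δ ∈ relSet ξ B D → δ' ∈ relSet ξ M F →
      g ≫ δ'' = δ ≫ d⟦(1 : ℤ)⟧' → δ'' ∈ relSet ξ M N) :
    IsExtriangulated (relExt hξ) (relReal hξ) where
  et1 := isAdditiveBifunctor_relExt hξ
  et2 := isAdditiveRealization_relReal hξ
  et3 := by
    intro A B Z A' B' Z' δ δ' x y x' y' h h' a b hab
    rw [relReal_eq_iff] at h h'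
    obtain ⟨c, hc₁, hc₂⟩ := complete_distinguished_triangle_morphism _ _ h h' a b hab
    exact ⟨c, relVal_injective hc₂, hc₁⟩
  et3op := by
    intro A B Z A' B' Z' δ δ' x y x' y' h h' b c hbc
    rw [relReal_eq_iff] at h h'
    obtain ⟨a, ha₁, ha₂⟩ := complete_distinguished_triangle_morphism₁ _ _ h h' b c hbc
    exact ⟨a, relVal_injective ha₂, ha₁⟩
  et4 := by
    intro A B D M F δ δ' f f' g g' h h'
    rw [relReal_eq_iff] at h h'
    obtain ⟨N, h₁, δ'', h''⟩ := distinguished_cocone_triangle (f ≫ g)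
    -- The octahedron provides all the data of ET4. Its third morphism is `f'_* δ'`, which is
    -- relative by closure under cobase change, so only membership of `δ''` has to come from
    -- `hmono`.
    let o := Triangulated.someOctahedron rfl h h' h''
    refine ⟨N, h₁, o.m₁, o.m₃, relMk hξ (hmono f f' (relVal δ) h o.m₃ (relVal δ') δ''
      (relVal_mem δ) (relVal_mem δ') o.comm₄), ?_, o.comm₁, o.comm₃, ?_,
      relVal_injective o.comm₂, relVal_injective o.comm₄⟩
    · rw [relReal_eq_iff]
      exact h''
    · rw [relReal_eq_iff]
      exact o.mem
  et4op := by
    intro D A B F M δ δ' f' f g' g h h'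
    rw [relReal_eq_iff] at h h'
    obtain ⟨N, h₁, δ'', h''⟩ := distinguished_cocone_triangle₁ (f ≫ g)
    let o := Triangulated.someOctahedron' rfl h h' h''
    refine ⟨N, h₁, o.m₁, o.m₃, relMk hξ (hepi g' g (relVal δ') h' o.m₁ (relVal δ) δ''
      (relVal_mem δ) (relVal_mem δ') o.comm₂.symm), ?_, o.comm₁, o.comm₄.symm, ?_,
      relVal_injective o.comm₃, relVal_injective o.comm₂⟩
    · rw [relReal_eq_iff]
      exact h''
    · rw [relReal_eq_iff]
      exact o.mem

theorem isExtriangulated_xiLower {X : ObjectProperty C} (hX : IsStableAdditive X)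
    (hξ : IsProperClass (xiLower X)) : IsExtriangulated (relExt hξ) (relReal hξ) := by
  refine isExtriangulated_of_comp hξ ?_ ?_
  · intro A B D F N f f' δ hT e δ' δ'' hδ hδ' h
    rw [mem_relSet_xiLower_iff hX] at hδ hδ' ⊢
    intro P hP u
    -- Since `δ'` is a ghost, `u ≫ δ''` dies in `ΣB`; hence it factors through the ghost `δ`.
    obtain ⟨t, ht⟩ := dist_factor_mor₃_right hT (u ≫ δ'') (by
      have := hδ' P hP (u ≫ e)
      rwa [Category.assoc, h, ← Category.assoc])
    rw [ht]
    exact hδ P hP t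
  · intro D B M F N g' g δ' hT d δ δ'' hδ hδ' h
    rw [mem_relSet_xiLower_iff hX] at hδ hδ' ⊢
    intro P hP u
    -- Since `δ'` is a ghost, `u` lifts along `g`, and `g ≫ δ''` factors through the ghost `δ`.
    obtain ⟨t, rfl⟩ := dist_factor_mor₂ hT u (hδ' P hP u)
    have := hδ P hP t
    rw [Category.assoc, h, reassoc_of% this, zero_comp]

end Relative

/-! ### Projectives, injectives and the triangulated case. -/

section Triangulated

variable {C : Type u} [Category.{v} C] [Preadditive C] [HasZeroObject C] [HasShift C ℤ]
  [∀ n : ℤ, (shiftFunctor C n).Additive] [Pretriangulated C] [IsTriangulated C]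
  {X Y : ObjectProperty C}

/-- Objects of `X` are projective: a ghost starting in `X` is zero, as seen on the identity. -/
lemma subsingleton_ext_left (hX : IsStableAdditive X) (hξ : IsProperClass (xiLower X)) {P : C}
    (hP : X P) (A : C) : Subsingleton (Ext1 (relExt hξ) P A) := by
  have key (δ : Ext1 (relExt hξ) P A) : relVal δ = 0 := by
    simpa using (mem_relSet_xiLower_iff hX _).1 (relVal_mem δ) P hP (𝟙 P)
  exact ⟨fun δ δ' => relVal_injective (by rw [key, key])⟩

/-- Objects of `Y` are injective: relative extensions are also coghosts, and one ending in `ΣI`, an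
object of `Y`, is zero. -/
lemma subsingleton_ext_right (h : IsBalancedPair X Y) (hξ : IsProperClass (xiLower X)) {I : C}
    (hI : Y I) (Z : C) : Subsingleton (Ext1 (relExt hξ) Z I) := by
  have key (δ : Ext1 (relExt hξ) Z I) : relVal δ = 0 := by
    simpa using (isGhost_iff_isCoghost h _).1
      ((mem_relSet_xiLower_iff h.stableAdditive_left _).1 (relVal_mem δ)) _
      (h.stableAdditive_right.shift_mem hI 1) (𝟙 _)
  exact ⟨fun δ δ' => relVal_injective (by rw [key, key])⟩

theorem isTriangulatedCat_iff (h : IsBalancedPair X Y) (hξ : IsProperClass (xiLower X)) :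
    IsTriangulatedCat (relExt hξ) (relReal hξ) ↔
      X = (fun A => IsZero A) ∧ Y = (fun A => IsZero A) := by
  have hX := h.stableAdditive_left
  have left {P : C} (hP : X P) := subsingleton_ext_left hX hξ hP
  have right {I : C} (hI : Y I) := subsingleton_ext_right h hξ hI
  have eqX := hX.eq_isZero
  have eqY := h.stableAdditive_right.eq_isZero
  constructor
  · rintro ⟨i₁, i₂, i₃, i₄, φ, -⟩
    refine ⟨eqX fun P hP => ?_, eqY fun I hI => ?_⟩
    -- The suspension here is the new one `i₁`, not the given one.
    · exact @isZero_of_subsingleton_hom_to_shift C _ _ i₁ P fun A =>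
        @subsingleton_hom_shift C _ _ i₁ _ φ P A (left hP A)
    · exact @isZero_of_subsingleton_hom_from_all C _ _ i₁ I fun Z =>
        @subsingleton_hom_shift C _ _ i₁ _ φ Z I (right hI Z)
  · rintro ⟨rfl, -⟩
    -- For `X = 0` every morphism is a ghost, so `E_ξ` is all of `Hom(-, Σ-)` and the given
    -- triangulation works.
    have hmem {Z A : C} (δ : Z ⟶ A⟦(1 : ℤ)⟧) : δ ∈ relSet (xiLower fun A : C => IsZero A) Z A :=
      (mem_relSet_xiLower_iff hX δ).2 fun P hP u => by rw [hP.eq_of_src u 0, zero_comp]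
    let e (Z A : C) : ((relExt hξ).obj (op Z)).obj A ≅ ((triExt C).obj (op Z)).obj A :=
      AddEquiv.toAddCommGrpIso
        { toFun := fun δ => relVal δ
          invFun := fun δ => relMk hξ (hmem δ)
          left_inv := fun _ => rfl
          right_inv := fun _ => rfl
          map_add' := fun _ _ => rfl }
    exact ⟨inferInstance, inferInstance, inferInstance, inferInstance,
      NatIso.ofComponents (fun Z => NatIso.ofComponents (fun A => e Z.unop A)
        (fun _ => rfl)) (fun _ => rfl), fun Z A δ => rfl⟩

end Triangulated

/-! ### The split exact structure and the exact case. -/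

section ExactCat

variable {C : Type u} [Category.{v} C] [Preadditive C] [HasZeroObject C] [HasShift C ℤ]
  [∀ n : ℤ, (shiftFunctor C n).Additive] [Pretriangulated C]

/-- The class of split short exact sequences, given as triangles with zero third morphism. -/
def splitPairs (C : Type u) [Category.{v} C] [Preadditive C] [HasZeroObject C] [HasShift C ℤ]
    [∀ n : ℤ, (shiftFunctor C n).Additive] [Pretriangulated C] : PairClass C :=
  fun A _ Z i p => Triangle.mk i p (0 : Z ⟶ A⟦(1 : ℤ)⟧) ∈ distTriang C

/-- A monomorphism in a triangulated category has zero connecting morphism, hence splits. Closure of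
inflations under composition thus reduces to that of monomorphisms. -/
lemma admMono_splitPairs_iff {A B : C} (i : A ⟶ B) : AdmMono (splitPairs C) i ↔ Mono i := by
  constructor
  · rintro ⟨Z, p, h⟩
    exact Triangle.mono₁ _ h rfl
  · intro hi
    obtain ⟨Z, p, δ, h⟩ := distinguished_cocone_triangle i
    obtain rfl : δ = 0 := Triangle.mor₃_eq_zero_of_mono₁ _ h hi
    exact ⟨Z, p, h⟩

lemma admEpi_splitPairs_iff {B Z : C} (p : B ⟶ Z) : AdmEpi (splitPairs C) p ↔ Epi p := by
  constructor
  · rintro ⟨A, i, h⟩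
    exact Triangle.epi₂ _ h rfl
  · intro hp
    obtain ⟨A, i, δ, h⟩ := distinguished_cocone_triangle₁ p
    obtain rfl : δ = 0 := Triangle.mor₃_eq_zero_of_epi₂ _ h hp
    exact ⟨A, i, h⟩

lemma exists_retraction_of_splitPairs {A B Z : C} {i : A ⟶ B} {p : B ⟶ Z}
    (h : splitPairs C i p) :
    ∃ (r : B ⟶ A) (s : Z ⟶ B), i ≫ r = 𝟙 A ∧ s ≫ p = 𝟙 Z ∧ i ≫ p = 0 ∧ s ≫ r = 0 ∧
      r ≫ i + p ≫ s = 𝟙 B := by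
  obtain ⟨e, he₁, he₂⟩ := exists_iso_binaryBiproduct_of_distTriang _ h rfl
  let e' : B ≅ A ⊞ Z := e
  replace he₁ : i ≫ e'.hom = biprod.inl := he₁
  rw [← Iso.eq_comp_inv] at he₁
  replace he₂ : p = e'.hom ≫ biprod.snd := he₂
  refine ⟨e'.hom ≫ biprod.fst, biprod.inr ≫ e'.inv, by simp [he₁], by simp [he₂],
    by simp [he₁, he₂], by simp, ?_⟩
  rw [he₁, he₂, ← cancel_epi e'.inv, ← cancel_mono e'.hom]
  simp [biprod.total]

theorem isExactStructure_splitPairs : IsExactStructure (splitPairs C) where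
  kernel_cokernel := by
    intro A B Z i p h
    obtain ⟨r, s, h₁, h₂, h₃, -, h₄⟩ := exists_retraction_of_splitPairs h
    have := (admMono_splitPairs_iff i).1 ⟨Z, p, h⟩
    have := (admEpi_splitPairs_iff p).1 ⟨A, i, h⟩
    refine ⟨h₃, ⟨KernelFork.IsLimit.ofι' i h₃ fun k hk => ⟨k ≫ r, ?_⟩⟩,
      ⟨CokernelCofork.IsColimit.ofπ' p h₃ fun k hk => ⟨s ≫ k, ?_⟩⟩⟩
    · have := congrArg (fun t => k ≫ t) h₄
      simpa [reassoc_of% hk] using this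
    · have := congrArg (fun t => t ≫ k) h₄
      simpa [hk] using this
  iso_closed := by
    intro A B Z A' B' Z' i p i' p' a b c h₁ h₂ h
    exact isomorphic_distinguished _ h _ (mkIso a b c h₁ h₂ (by simp)).symm
  id_mono A := (admMono_splitPairs_iff _).2 inferInstance
  id_epi A := (admEpi_splitPairs_iff _).2 inferInstance
  comp_mono := by
    intro A B D i j hi hj
    rw [admMono_splitPairs_iff] at *
    exact mono_comp i j
  comp_epi := by
    intro A B D i j hi hj
    rw [admEpi_splitPairs_iff] at *
    exact epi_comp i j
  pushout := by
    rintro A B A' i f ⟨Z, p, h⟩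
    obtain ⟨r, s, h₁, h₂, h₃, h₅, h₄⟩ := exists_retraction_of_splitPairs h
    -- Under `B ≅ A ⊞ Z` the map `i` is the inclusion of `A`, so its pushout along `f` just replaces
    -- `A` by `A'`.
    refine ⟨A' ⊞ Z, biprod.lift (r ≫ f) p, biprod.inl, ⟨⟨?_⟩, ⟨PushoutCocone.IsColimit.mk _
      (fun t => biprod.desc t.inr (s ≫ t.inl)) (fun t => ?_) (fun t => ?_) fun t m hm₁ hm₂ => ?_⟩⟩,
      (admMono_splitPairs_iff _).2 inferInstance⟩
    · ext <;> simp [reassoc_of% h₁, h₃]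
    · have := congrArg (fun u => u ≫ t.inl) h₄
      have hc := t.condition
      simpa [biprod.lift_desc, hc] using this
    · simp
    · ext
      · simp [← hm₂]
      · rw [← hm₁]
        simp only [biprod.inr_desc]
        rw [← Category.assoc]
        congr 1
        ext <;> simp [reassoc_of% h₅, h₂]
  pullback := by
    rintro B Z Z' p f ⟨A, i, h⟩
    obtain ⟨r, s, h₁, h₂, h₃, h₅, h₄⟩ := exists_retraction_of_splitPairs h
    -- Dually, the pullback replaces `Z` by `Z'` in `B ≅ A ⊞ Z`.
    refine ⟨A ⊞ Z', biprod.snd, biprod.desc i (f ≫ s), ⟨⟨?_⟩, ⟨PullbackCone.IsLimit.mk _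
      (fun t => biprod.lift (t.snd ≫ r) t.fst) (fun t => ?_) (fun t => ?_)
      fun t m hm₁ hm₂ => ?_⟩⟩, (admEpi_splitPairs_iff _).2 inferInstance⟩
    · ext <;> simp [h₂, h₃]
    · simp
    · have := congrArg (fun u => t.snd ≫ u) h₄
      have hc := t.condition
      simpa [biprod.lift_desc, reassoc_of% hc] using this
    · ext
      · rw [← hm₂]
        simp only [biprod.lift_fst, Category.assoc]
        congr 1
        ext <;> simp [h₅, h₁]
      · simp [← hm₁]

variable [IsTriangulated C] {X Y : ObjectProperty C}

theorem isExactCat_iff (h : IsBalancedPair X Y) (hξ : IsProperClass (xiLower X)) :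
    IsExactCat (relExt hξ) (relReal hξ) ↔ X = ⊤ ∧ Y = ⊤ := by
  have hX := h.stableAdditive_left
  have hY := h.stableAdditive_right
  constructor
  · intro hE
    -- In an exact structure `i` is a kernel, hence monic, which forces `δ = 0`. Applied to
    -- approximation triangles, this makes every object a retract of one in `X` and of one in `Y`.
    have split {A B Z : C} (i : A ⟶ B) (p : B ⟶ Z) (δ : Z ⟶ A⟦(1 : ℤ)⟧)
        (hT : Triangle.mk i p δ ∈ xiLower X) : splitPairs C i p := by
      obtain ⟨w, ⟨hi⟩, -⟩ := hE.kernel_cokernel i p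
        ⟨relMk hξ ((hξ.mem_relSet_iff hT.1).2 hT), (relReal_eq_iff _ _ _).2 hT.1⟩
      have : Mono i := mono_of_isLimit_fork hi
      obtain rfl : δ = 0 := Triangle.mor₃_eq_zero_of_mono₁ _ hT.1 this
      exact hT.1
    constructor
    · ext M
      refine ⟨fun _ => trivial, fun _ => ?_⟩
      obtain ⟨P, d, aug, hP, K, g, f, h₀, -, hT, -⟩ := h.resolution M
      obtain ⟨r, s, -, hs, -⟩ := exists_retraction_of_splitPairs (split _ _ _ hT.1)
      exact hX.retract_mem ⟨s, aug, hs⟩ (hP 0)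
    · ext N
      refine ⟨fun _ => trivial, fun _ => ?_⟩
      obtain ⟨I, d, aug, hI, L, f, g, h₀, -, hT, -⟩ := h.coresolution N
      obtain ⟨r, s, hr, -⟩ := exists_retraction_of_splitPairs (split _ _ _ (by
        rw [xiLower_eq_xiUpper h]
        exact hT.1))
      exact hY.retract_mem ⟨aug, r, hr⟩ (hI 0)
  · rintro ⟨rfl, -⟩
    -- For `X = ⊤` every object is projective, so the conflations are exactly the split sequences.
    have e : (fun A _ Z i p => ∃ δ : Ext1 (relExt hξ) Z A, relReal hξ δ = seqClass i p) =
        splitPairs C := ?_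
    · change IsExactStructure _
      rw [e]
      exact isExactStructure_splitPairs
    ext A B Z i p
    constructor
    · rintro ⟨δ, hδ⟩
      have := subsingleton_ext_left hX hξ (P := Z) trivial A
      rw [Subsingleton.elim δ 0, relReal_eq_iff] at hδ
      exact hδ
    · exact fun hT => ⟨0, (relReal_eq_iff _ _ _).2 hT⟩

end ExactCat

end RelTri

theorem theorem1p2 {C : Type u} [Category.{v} C] [Preadditive C] [HasZeroObject C] [HasShift C ℤ]
    [∀ n : ℤ, (shiftFunctor C n).Additive] [Pretriangulated C] [IsTriangulated C]
    (X Y : ObjectProperty C) (hXY : RelTri.IsBalancedPair X Y) :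
    RelTri.xiLower X = RelTri.xiUpper Y ∧
    ∃ hξ : RelTri.IsProperClass (RelTri.xiLower X),
      RelTri.IsExtriangulated (RelTri.relExt hξ) (RelTri.relReal hξ) ∧
      (RelTri.IsTriangulatedCat (RelTri.relExt hξ) (RelTri.relReal hξ) ↔
        X = (fun A => IsZero A) ∧ Y = (fun A => IsZero A)) ∧
      (RelTri.IsExactCat (RelTri.relExt hξ) (RelTri.relReal hξ) ↔ X = ⊤ ∧ Y = ⊤) := by
  have hξ := RelTri.isProperClass_xiLower hXY.stableAdditive_left
  exact ⟨RelTri.xiLower_eq_xiUpper hXY, hξ,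
    RelTri.isExtriangulated_xiLower hXY.stableAdditive_left hξ,
    RelTri.isTriangulatedCat_iff hXY hξ, RelTri.isExactCat_iff hXY hξ⟩
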